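/- For $n\in\mathbb{N}=\{0,1,2,\ldots\}$ let $H_n=\sum_{0<j\le n}\frac1j$ denote the $n$-th harmonic number (so $H_0=0$). For each integer $k\ge 1$ put $$\mathcal H(k)=10H_{6k-1}-5H_{3k-1}-16H_{2k-1}+5H_{k-1}.$$ Then the following series converges absolutely, and $$\sum_{k=1}^\infty \frac{256^k\big((22k-1)\mathcal H(k)-50\big)}{(2k-1)\,k^2\binom{3k}{k}\binom{6k}{3k}}=-16\pi^3 .$$ -/

import Mathlib

/-- The combination `10 H_{6k-1} - 5 H_{3k-1} - 16 H_{2k-1} + 5 H_{k-1}` of harmonic numbers,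
used only for `k ≥ 1`, where no natural-number subtraction truncates. -/
def harmonicCombination (k : ℕ) : ℚ :=
  10 * harmonic (6 * k - 1) - 5 * harmonic (3 * k - 1) - 16 * harmonic (2 * k - 1)
    + 5 * harmonic (k - 1)

/-- The `k`-th summand of the series, used only for `k ≥ 1`. -/
noncomputable def seriesTerm (k : ℕ) : ℝ :=
  (256 : ℝ) ^ k * ((22 * (k : ℝ) - 1) * (harmonicCombination k : ℝ) - 50) /
    ((2 * (k : ℝ) - 1) * (k : ℝ) ^ 2 * (Nat.choose (3 * k) k : ℝ)
      * (Nat.choose (6 * k) (3 * k) : ℝ))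

/-! The series is a derivative of an accelerated form of `∑ (-1)^k / ((x+k)(y+k))`. That summand is
`F(0,k)` for a WZ pair, `F(n+1,k) - F(n,k) = G(n,k+1) - G(n,k)` (`wzF_sub_eq_wzG_sub`). Summing over
a rectangle and letting its sides grow, the far edges vanish, so `∑ G(n,0) = ∑ F(0,k)` for all `x`,
`y` near `1/2` (`hasSum_wzG`).

Now put `x = 1/2 + 7e`, `y = 1/2 - 5e` and differentiate at `e = 0`, termwise by uniform bounds
(`hasSum_deriv_wzG`). The right side becomes `-16 ∑ (-1)^k/(2k+1)^3 = -π^3/2`. On the left, `F(n,0)`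
at `e = 0` is the binomial quotient of the series up to a simple factor (`wzF_half_eq`), its
logarithmic derivative gives the harmonic numbers (`logDeriv_wzF_eq`), and the certificate gives
`22k - 1`, with `k = n + 1` (`deriv_wzG_eq_seriesTerm`). Multiplication by 32 gives the claim.

The slope `-5` of `y` yields `10, -5, -10, 5`; the slope `(-5-7)/2 = -6` of `(y-x)/2` turns `-10`
into `-16`. -/

open Finset

/-- The rising factorial `s (s + 1) ⋯ (s + m - 1)`. -/
noncomputable def rising (s : ℂ) (m : ℕ) : ℂ := ∏ j ∈ range m, (s + j)

theorem rising_zero (s : ℂ) : rising s 0 = 1 := by simp [rising]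

theorem rising_succ (s : ℂ) (m : ℕ) : rising s (m + 1) = rising s m * (s + m) := by
  simp [rising, prod_range_succ]

theorem rising_succ_left (s : ℂ) (m : ℕ) : rising s (m + 1) = s * rising (s + 1) m := by
  rw [rising, prod_range_succ', mul_comm, rising]
  congr 1
  · simp
  · refine prod_congr rfl fun j _ => ?_
    push_cast
    ring

theorem rising_ne_zero {s : ℂ} {m : ℕ} (h : ∀ j < m, s + j ≠ 0) : rising s m ≠ 0 :=
  prod_ne_zero_iff.2 fun j hj => h j (mem_range.1 hj)

/-! ### The WZ pair and its recurrences -/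

/-- First member of the Wilf–Zeilberger pair accelerating `∑ (-1) ^ k / ((x + k) * (y + k))`. -/
noncomputable def wzF (x y : ℂ) (n k : ℕ) : ℂ :=
  (-1) ^ (n + k) * (2 * n).factorial * rising (1 + (y - x) / 2) (2 * n) /
    (rising (y + n + k) (2 * n + 1) * rising (x + k - n) (2 * n + 1))

/-- The rational certificate of the Wilf–Zeilberger pair. -/
noncomputable def wzCert (x y : ℂ) (n k : ℕ) : ℂ :=
  1 - (y + n + k) / (2 * (y + 3 * n + k + 1)) -
    (y + n + k) * (2 * n + 1) * (1 + (y - x) / 2 + 2 * n) /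
      (2 * (1 - x + n - k) * (y + 3 * n + k + 1) * (y + 3 * n + k + 2))

/-- Second member of the Wilf–Zeilberger pair. -/
noncomputable def wzG (x y : ℂ) (n k : ℕ) : ℂ := wzF x y n k * wzCert x y n k

section recurrences

variable {x y : ℂ}

theorem wzF_zero_left (k : ℕ) : wzF x y 0 k = (-1) ^ k / ((x + k) * (y + k)) := by
  simp [wzF, rising, mul_comm]

/-- The factors in `x` are centred at `x + k`, so offsets of both signs occur; those in `y` only
have nonnegative offsets. Hence `ℤ` in `hx` but `ℕ` in `hy`. -/
theorem wzF_succ_right (hx : ∀ m : ℤ, x + m ≠ 0) (hy : ∀ m : ℕ, y + m ≠ 0) (n k : ℕ) :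
    wzF x y n (k + 1) =
      -((y + n + k) * (x + k - n) / ((y + 3 * n + k + 1) * (x + k + n + 1))) * wzF x y n k := by
  have hy1 : rising (y + n + k) (2 * n + 1) ≠ 0 :=
    rising_ne_zero fun j _ => by simpa [add_assoc] using hy (n + (k + j))
  have hx1 : rising (x + k - n) (2 * n + 1) ≠ 0 :=
    rising_ne_zero fun j _ => by
      have := hx (k - n + j); push_cast at this
      intro h; exact this (by rw [← h]; ring)
  have hy2 : rising (y + n + k + 1) (2 * n + 1) ≠ 0 :=
    rising_ne_zero fun j _ => by
      have := hy (n + k + 1 + j); push_cast at this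
      intro h; exact this (by rw [← h]; ring)
  have hx2 : rising (x + k - n + 1) (2 * n + 1) ≠ 0 :=
    rising_ne_zero fun j _ => by
      have := hx (k - n + 1 + j); push_cast at this
      intro h; exact this (by rw [← h]; ring)
  have hy3 : y + 3 * n + k + 1 ≠ 0 := by
    have := hy (3 * n + k + 1); push_cast at this
    intro h; exact this (by rw [← h]; ring)
  have hx3 : x + k + n + 1 ≠ 0 := by
    have := hx (k + n + 1); push_cast at this
    intro h; exact this (by rw [← h]; ring)
  have ey : (y + n + k) * rising (y + n + k + 1) (2 * n + 1) =
      rising (y + n + k) (2 * n + 1) * (y + 3 * n + k + 1) := by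
    rw [← rising_succ_left, rising_succ]; push_cast; ring
  have ex : (x + k - n) * rising (x + k - n + 1) (2 * n + 1) =
      rising (x + k - n) (2 * n + 1) * (x + k + n + 1) := by
    rw [← rising_succ_left, rising_succ]; push_cast; ring
  have ey' : y + n + ((k + 1 : ℕ) : ℂ) = y + n + k + 1 := by push_cast; ring
  have ex' : x + ((k + 1 : ℕ) : ℂ) - n = x + k - n + 1 := by push_cast; ring
  rw [wzF, wzF, ey', ex', ← add_assoc, pow_succ]
  rw [← mul_div_assoc, div_eq_div_iff (mul_ne_zero hy2 hx2) (mul_ne_zero hy1 hx1)]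
  rw [neg_mul, neg_mul, div_mul_eq_mul_div, div_mul_eq_mul_div, ← neg_div,
    eq_div_iff (mul_ne_zero hy3 hx3)]
  linear_combination (-(-1) ^ (n + k) * (2 * n).factorial * rising (1 + (y - x) / 2) (2 * n)) *
    (-(rising (y + n + k) (2 * n + 1) * (y + 3 * n + k + 1)) * ex -
      (x + k - n) * rising (x + k - n + 1) (2 * n + 1) * ey)

theorem wzF_succ_left (hx : ∀ m : ℤ, x + m ≠ 0) (hy : ∀ m : ℕ, y + m ≠ 0) (n k : ℕ) :
    wzF x y (n + 1) k =
      -((2 * n + 1) * (2 * n + 2) * (1 + (y - x) / 2 + 2 * n) * (2 + (y - x) / 2 + 2 * n) *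
        (y + n + k) / ((y + 3 * n + k + 1) * (y + 3 * n + k + 2) * (y + 3 * n + k + 3) *
          (x + k - n - 1) * (x + k + n + 1))) * wzF x y n k := by
  have hy1 : rising (y + n + k) (2 * n + 1) ≠ 0 :=
    rising_ne_zero fun j _ => by simpa [add_assoc] using hy (n + (k + j))
  have hx1 : rising (x + k - n) (2 * n + 1) ≠ 0 :=
    rising_ne_zero fun j _ => by
      have := hx (k - n + j); push_cast at this
      intro h; exact this (by rw [← h]; ring)
  have hy0 : y + n + k ≠ 0 := by simpa [add_assoc] using hy (n + k)
  have hy3 : y + 3 * n + k + 1 ≠ 0 := by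
    have := hy (3 * n + k + 1); push_cast at this
    intro h; exact this (by rw [← h]; ring)
  have hy4 : y + 3 * n + k + 2 ≠ 0 := by
    have := hy (3 * n + k + 2); push_cast at this
    intro h; exact this (by rw [← h]; ring)
  have hy5 : y + 3 * n + k + 3 ≠ 0 := by
    have := hy (3 * n + k + 3); push_cast at this
    intro h; exact this (by rw [← h]; ring)
  have hx3 : x + k + n + 1 ≠ 0 := by
    have := hx (k + n + 1); push_cast at this
    intro h; exact this (by rw [← h]; ring)
  have hx4 : x + k - n - 1 ≠ 0 := by
    have := hx (k - n - 1); push_cast at this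
    intro h; exact this (by rw [← h]; ring)
  have ey : rising (y + ((n + 1 : ℕ) : ℂ) + k) (2 * (n + 1) + 1) =
      rising (y + n + k) (2 * n + 1) *
        ((y + 3 * n + k + 1) * (y + 3 * n + k + 2) * (y + 3 * n + k + 3)) / (y + n + k) := by
    rw [eq_div_iff hy0, mul_comm]
    have e : y + ((n + 1 : ℕ) : ℂ) + k = y + n + k + 1 := by push_cast; ring
    rw [e, ← rising_succ_left, show 2 * (n + 1) + 1 + 1 = 2 * n + 1 + 1 + 1 + 1 by ring,
      rising_succ, rising_succ, rising_succ]
    push_cast; ring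
  have ex : rising (x + k - ((n + 1 : ℕ) : ℂ)) (2 * (n + 1) + 1) =
      rising (x + k - n) (2 * n + 1) * ((x + k - n - 1) * (x + k + n + 1)) := by
    have e : x + k - ((n + 1 : ℕ) : ℂ) = x + k - n - 1 := by push_cast; ring
    rw [e, show 2 * (n + 1) + 1 = 2 * n + 1 + 1 + 1 by ring, rising_succ, rising_succ_left]
    push_cast
    rw [sub_add_cancel]; ring
  have em : rising (1 + (y - x) / 2) (2 * (n + 1)) = rising (1 + (y - x) / 2) (2 * n) *
      ((1 + (y - x) / 2 + 2 * n) * (2 + (y - x) / 2 + 2 * n)) := by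
    rw [show 2 * (n + 1) = 2 * n + 1 + 1 by ring, rising_succ, rising_succ]
    push_cast; ring
  have ef : (((2 * (n + 1)).factorial : ℕ) : ℂ) =
      (2 * n + 1) * (2 * n + 2) * (2 * n).factorial := by
    rw [show 2 * (n + 1) = 2 * n + 1 + 1 by ring, Nat.factorial_succ, Nat.factorial_succ]
    push_cast; ring
  rw [wzF, wzF, ey, ex, em, ef, show n + 1 + k = n + k + 1 by ring, pow_succ]
  generalize rising (y + n + k) (2 * n + 1) = A at *
  generalize rising (x + k - n) (2 * n + 1) = B at *
  generalize rising (1 + (y - x) / 2) (2 * n) = C at *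
  field_simp

/-- The WZ equation divided by `F(n,k)`. The substitution `p = y+3n+k+1`, `q = x+k-n`, `c = 2n+1`
leaves three variables, since `1+(y-x)/2+2n = (1+p-q)/2`. -/
theorem wz_certificate_identity {p q c : ℂ} (hp : p ≠ 0) (hp1 : p + 1 ≠ 0) (hp2 : p + 2 ≠ 0)
    (hq : q ≠ 0) (hq1 : q - 1 ≠ 0) (hqc : q + c ≠ 0) :
    -(c * (c + 1) * ((1 + p - q) / 2) * ((1 + p - q) / 2 + 1) * (p - c) /
        (p * (p + 1) * (p + 2) * (q - 1) * (q + c))) - 1 =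
      -((p - c) * q / (p * (q + c))) * (1 - (p - c + 1) / (2 * (p + 1)) -
        (p - c + 1) * c * ((1 + p - q) / 2) / (2 * -q * (p + 1) * (p + 2))) -
      (1 - (p - c) / (2 * p) -
        (p - c) * c * ((1 + p - q) / 2) / (2 * -(q - 1) * p * (p + 1))) := by
  field_simp
  ring

theorem wzF_sub_eq_wzG_sub (hx : ∀ m : ℤ, x + m ≠ 0) (hy : ∀ m : ℕ, y + m ≠ 0) (n k : ℕ) :
    wzF x y (n + 1) k - wzF x y n k = wzG x y n (k + 1) - wzG x y n k := by
  have hy3 : y + 3 * n + k + 1 ≠ 0 := by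
    have := hy (3 * n + k + 1); push_cast at this
    intro h; exact this (by rw [← h]; ring)
  have hy4 : y + 3 * n + k + 2 ≠ 0 := by
    have := hy (3 * n + k + 2); push_cast at this
    intro h; exact this (by rw [← h]; ring)
  have hy5 : y + 3 * n + k + 3 ≠ 0 := by
    have := hy (3 * n + k + 3); push_cast at this
    intro h; exact this (by rw [← h]; ring)
  have hx3 : x + k + n + 1 ≠ 0 := by
    have := hx (k + n + 1); push_cast at this
    intro h; exact this (by rw [← h]; ring)
  have hx4 : x + k - n - 1 ≠ 0 := by
    have := hx (k - n - 1); push_cast at this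
    intro h; exact this (by rw [← h]; ring)
  have hx5 : x + k - n ≠ 0 := by
    have := hx (k - n); push_cast at this
    intro h; exact this (by rw [← h]; ring)
  have key := wz_certificate_identity (p := y + 3 * n + k + 1) (q := x + k - n) (c := 2 * n + 1)
    hy3 (by rwa [add_assoc, one_add_one_eq_two]) (by rwa [add_assoc, show (1 : ℂ) + 2 = 3 by norm_num])
    hx5 hx4 (by rw [show x + k - n + (2 * n + 1) = x + k + n + 1 by ring]; exact hx3)
  have key' : -((2 * n + 1) * (2 * n + 2) * (1 + (y - x) / 2 + 2 * n) * (2 + (y - x) / 2 + 2 * n) *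
        (y + n + k) / ((y + 3 * n + k + 1) * (y + 3 * n + k + 2) * (y + 3 * n + k + 3) *
          (x + k - n - 1) * (x + k + n + 1))) - 1 =
      -((y + n + k) * (x + k - n) / ((y + 3 * n + k + 1) * (x + k + n + 1))) *
        wzCert x y n (k + 1) - wzCert x y n k := by
    rw [wzCert, wzCert]
    convert key using 3
    all_goals push_cast
    all_goals ring_nf
  rw [wzG, wzG, wzF_succ_left hx hy, wzF_succ_right hx hy]
  linear_combination wzF x y n k * key'

/-- Discrete Green's theorem: the WZ equation summed over an `N × K` rectangle telescopes to its
four edges. -/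
theorem sum_wzG_sub_sum_wzF (hx : ∀ m : ℤ, x + m ≠ 0) (hy : ∀ m : ℕ, y + m ≠ 0) (N K : ℕ) :
    ∑ n ∈ range N, wzG x y n 0 - ∑ k ∈ range K, wzF x y 0 k =
      ∑ n ∈ range N, wzG x y n K - ∑ k ∈ range K, wzF x y N k := by
  have h1 : ∑ k ∈ range K, ∑ n ∈ range N, (wzF x y (n + 1) k - wzF x y n k) =
      ∑ k ∈ range K, wzF x y N k - ∑ k ∈ range K, wzF x y 0 k := by
    rw [← sum_sub_distrib]
    exact sum_congr rfl fun k _ => sum_range_sub (fun n => wzF x y n k) N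
  have h2 : ∑ n ∈ range N, ∑ k ∈ range K, (wzG x y n (k + 1) - wzG x y n k) =
      ∑ n ∈ range N, wzG x y n K - ∑ n ∈ range N, wzG x y n 0 := by
    rw [← sum_sub_distrib]
    exact sum_congr rfl fun n _ => sum_range_sub (fun k => wzG x y n k) K
  rw [sum_comm] at h1
  simp only [wzF_sub_eq_wzG_sub hx hy] at h1
  linear_combination h2 - h1

end recurrences

/-! ### Uniform bounds near `1/2` and the limit of the rectangle -/

section bounds

open Filter Topology

theorem norm_add_real_le {z : ℂ} (hz : ‖z - 1 / 2‖ ≤ 1 / 10) (t : ℝ) :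
    ‖z + t‖ ≤ |t + 1 / 2| + 1 / 10 := by
  have e : z + t = ((t + 1 / 2 : ℝ) : ℂ) + (z - 1 / 2) := by push_cast; ring
  have h : ‖((t + 1 / 2 : ℝ) : ℂ)‖ = |t + 1 / 2| := by rw [Complex.norm_real, Real.norm_eq_abs]
  rw [e]
  linarith [norm_add_le ((t + 1 / 2 : ℝ) : ℂ) (z - 1 / 2)]

theorem le_norm_add_real {z : ℂ} (hz : ‖z - 1 / 2‖ ≤ 1 / 10) (t : ℝ) :
    |t + 1 / 2| - 1 / 10 ≤ ‖z + t‖ := by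
  have e : ((t + 1 / 2 : ℝ) : ℂ) = (z + t) - (z - 1 / 2) := by push_cast; ring
  have h : ‖((t + 1 / 2 : ℝ) : ℂ)‖ = |t + 1 / 2| := by rw [Complex.norm_real, Real.norm_eq_abs]
  have := norm_sub_le (z + t) (z - 1 / 2)
  rw [← e, h] at this
  linarith

theorem add_int_ne_zero {z : ℂ} (hz : ‖z - 1 / 2‖ ≤ 1 / 10) (m : ℤ) : z + m ≠ 0 := by
  intro h
  have h1 := le_norm_add_real hz m
  rw [show ((m : ℝ) : ℂ) = m by push_cast; rfl, h, norm_zero] at h1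
  have h2 : |(m : ℝ) + 1 / 2| ≤ 1 / 10 := by linarith
  rw [abs_le] at h2
  have h3 : (-1 : ℝ) < m := by linarith [h2.1]
  have h4 : (m : ℝ) < 0 := by linarith [h2.2]
  have h5 : (-1 : ℤ) < m := by exact_mod_cast h3
  have h6 : m < 0 := by exact_mod_cast h4
  omega

theorem add_nat_ne_zero {z : ℂ} (hz : ‖z - 1 / 2‖ ≤ 1 / 10) (m : ℕ) : z + m ≠ 0 := by
  simpa using add_int_ne_zero hz m

variable {x y : ℂ} (hx : ‖x - 1 / 2‖ ≤ 1 / 10) (hy : ‖y - 1 / 2‖ ≤ 1 / 10)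
include hx hy

theorem norm_half_sub_le : ‖(y - x) / 2‖ ≤ 1 / 10 := by
  have e : y - x = (y - 1 / 2) - (x - 1 / 2) := by ring
  have := norm_sub_le (y - 1 / 2) (x - 1 / 2)
  rw [norm_div, e, Complex.norm_ofNat]
  linarith

/-- The ratio is chosen so that its products telescope to a summable `O(1/k^2)`. It needs `n ≥ 1`,
through `3n + k + 1.4 ≥ n + k + 3`; the row `n = 0` is bounded directly. -/
theorem norm_wzF_succ_right_le {n : ℕ} (hn : 1 ≤ n) (k : ℕ) :
    ‖wzF x y n (k + 1)‖ ≤ (n + k + 1) / (n + k + 3) * ‖wzF x y n k‖ := by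
  have hn' : (1 : ℝ) ≤ n := by exact_mod_cast hn
  have hk' : (0 : ℝ) ≤ k := by positivity
  rw [wzF_succ_right (add_int_ne_zero hx) (add_nat_ne_zero hy), norm_mul, norm_neg, norm_div,
    norm_mul, norm_mul]
  refine mul_le_mul_of_nonneg_right ?_ (norm_nonneg _)
  have h1 : ‖y + n + k‖ ≤ n + k + 1 := by
    have := norm_add_real_le hy (n + k)
    rw [abs_of_nonneg (by positivity)] at this
    push_cast at this; rw [← add_assoc] at this
    linarith
  have h2 : (n + k + 3 : ℝ) ≤ ‖y + 3 * n + k + 1‖ := by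
    have := le_norm_add_real hy (3 * n + k + 1)
    rw [abs_of_nonneg (by positivity)] at this
    push_cast at this; rw [← add_assoc, ← add_assoc] at this
    linarith
  have h3 : ‖x + k - n‖ ≤ n + k + 1.4 := by
    have := norm_add_real_le hx (k - n)
    have h : |(k - n : ℝ) + 1 / 2| ≤ n + k + 1 / 2 := by rw [abs_le]; constructor <;> linarith
    push_cast at this; rw [← add_sub_assoc] at this
    linarith
  have h4 : (n + k + 1.4 : ℝ) ≤ ‖x + k + n + 1‖ := by
    have := le_norm_add_real hx (k + n + 1)
    rw [abs_of_nonneg (by positivity)] at this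
    push_cast at this; rw [← add_assoc, ← add_assoc] at this
    linarith
  rw [mul_div_mul_comm]
  have h5 : ‖x + k - n‖ / ‖x + k + n + 1‖ ≤ 1 := div_le_one_of_le₀ (h3.trans h4) (norm_nonneg _)
  calc _ ≤ ‖y + n + k‖ / ‖y + 3 * n + k + 1‖ * 1 := by gcongr
    _ ≤ _ := by rw [mul_one]; gcongr

theorem norm_wzF_le {n : ℕ} (hn : 1 ≤ n) (k : ℕ) :
    ‖wzF x y n k‖ ≤ ‖wzF x y n 0‖ * ((n + 1) * (n + 2) / ((n + k + 1) * (n + k + 2))) := by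
  induction k with
  | zero =>
    simp only [CharP.cast_eq_zero, add_zero]
    rw [div_self (by positivity), mul_one]
  | succ k ih =>
    calc _ ≤ _ := norm_wzF_succ_right_le hx hy hn k
      _ ≤ (n + k + 1) / (n + k + 3) *
          (‖wzF x y n 0‖ * ((n + 1) * (n + 2) / ((n + k + 1) * (n + k + 2)))) := by gcongr
      _ = _ := by push_cast; field_simp; ring

theorem sum_norm_wzF_le {n : ℕ} (hn : 1 ≤ n) (K : ℕ) :
    ∑ k ∈ range K, ‖wzF x y n k‖ ≤ ‖wzF x y n 0‖ * (n + 2) := by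
  -- Telescoping by partial fractions.
  have h : ∑ k ∈ range K, ((n + 1) * (n + 2) / ((n + k + 1) * (n + k + 2)) : ℝ) =
      (n + 2) - (n + 1) * (n + 2) / (n + K + 1) := by
    induction K with
    | zero =>
      rw [range_zero, sum_empty, Nat.cast_zero, add_zero,
        mul_div_cancel_left₀ _ (by positivity), sub_self]
    | succ K ih => rw [sum_range_succ, ih]; push_cast; field_simp; ring
  calc _ ≤ ∑ k ∈ range K,
        ‖wzF x y n 0‖ * ((n + 1) * (n + 2) / ((n + k + 1) * (n + k + 2))) :=
        sum_le_sum fun k _ => norm_wzF_le hx hy hn k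
    _ ≤ _ := by
        rw [← mul_sum, h]
        gcongr
        linarith [show (0 : ℝ) ≤ (n + 1) * (n + 2) / (n + K + 1) by positivity]

theorem norm_wzF_zero_left_le (k : ℕ) : ‖wzF x y 0 k‖ ≤ 25 / 4 * (1 / ((k : ℝ) + 1) ^ 2) := by
  rw [wzF_zero_left, norm_div, norm_pow, norm_neg, norm_one, one_pow, norm_mul]
  have h : ∀ z : ℂ, ‖z - 1 / 2‖ ≤ 1 / 10 → 2 / 5 * ((k : ℝ) + 1) ≤ ‖z + k‖ := fun z hz => by
    have := le_norm_add_real hz k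
    rw [abs_of_nonneg (by positivity)] at this
    push_cast at this
    linarith [show (0 : ℝ) ≤ k by positivity]
  calc 1 / (‖x + k‖ * ‖y + k‖) ≤ 1 / ((2 / 5 * ((k : ℝ) + 1)) * (2 / 5 * ((k : ℝ) + 1))) := by
        have := h x hx
        have := h y hy
        gcongr
    _ = _ := by field_simp; norm_num

theorem norm_wzF_succ_left_le (n : ℕ) : ‖wzF x y (n + 1) 0‖ ≤ 3 / 4 * ‖wzF x y n 0‖ := by
  have hn : (0 : ℝ) ≤ n := by positivity
  rw [wzF_succ_left (add_int_ne_zero hx) (add_nat_ne_zero hy), norm_mul, norm_neg, norm_div]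
  refine mul_le_mul_of_nonneg_right ?_ (norm_nonneg _)
  simp only [norm_mul, CharP.cast_eq_zero, add_zero]
  have hm := norm_half_sub_le hx hy
  have a1 : ‖(2 * n + 1 : ℂ)‖ = 2 * n + 1 := by
    rw [show (2 * n + 1 : ℂ) = ((2 * n + 1 : ℕ) : ℂ) by push_cast; ring, Complex.norm_natCast]
    push_cast; ring
  have a2 : ‖(2 * n + 2 : ℂ)‖ = 2 * n + 2 := by
    rw [show (2 * n + 2 : ℂ) = ((2 * n + 2 : ℕ) : ℂ) by push_cast; ring, Complex.norm_natCast]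
    push_cast; ring
  have a3 : ‖1 + (y - x) / 2 + 2 * n‖ ≤ 2 * n + 1.1 := by
    have := norm_add_le (2 * n + 1 : ℂ) ((y - x) / 2)
    rw [a1] at this
    rw [show 1 + (y - x) / 2 + 2 * n = 2 * n + 1 + (y - x) / 2 by ring]
    linarith
  have a4 : ‖2 + (y - x) / 2 + 2 * n‖ ≤ 2 * n + 2.1 := by
    have := norm_add_le (2 * n + 2 : ℂ) ((y - x) / 2)
    rw [a2] at this
    rw [show 2 + (y - x) / 2 + 2 * n = 2 * n + 2 + (y - x) / 2 by ring]
    linarith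
  have a5 : ‖y + n‖ ≤ n + 0.6 := by
    have := norm_add_real_le hy n
    rw [abs_of_nonneg (by positivity)] at this
    push_cast at this
    linarith
  have b1 : 3 * n + 1.4 ≤ ‖y + 3 * n + 1‖ := by
    have := le_norm_add_real hy (3 * n + 1)
    rw [abs_of_nonneg (by positivity)] at this
    push_cast at this; rw [← add_assoc] at this
    linarith
  have b2 : 3 * n + 2.4 ≤ ‖y + 3 * n + 2‖ := by
    have := le_norm_add_real hy (3 * n + 2)
    rw [abs_of_nonneg (by positivity)] at this
    push_cast at this; rw [← add_assoc] at this
    linarith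
  have b3 : 3 * n + 3.4 ≤ ‖y + 3 * n + 3‖ := by
    have := le_norm_add_real hy (3 * n + 3)
    rw [abs_of_nonneg (by positivity)] at this
    push_cast at this; rw [← add_assoc] at this
    linarith
  have b4 : n + 0.4 ≤ ‖x - n - 1‖ := by
    have := le_norm_add_real hx (-n - 1)
    rw [abs_of_nonpos (by linarith)] at this
    push_cast at this
    rw [show x + (-(n : ℂ) - 1) = x - n - 1 by ring] at this
    linarith
  have b5 : n + 1.4 ≤ ‖x + n + 1‖ := by
    have := le_norm_add_real hx (n + 1)
    rw [abs_of_nonneg (by positivity)] at this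
    push_cast at this; rw [← add_assoc] at this
    linarith
  rw [a1, a2]
  calc _ ≤ (2 * n + 1 : ℝ) * (2 * n + 2) * (2 * n + 1.1) * (2 * n + 2.1) * (n + 0.6) /
      ((3 * n + 1.4) * (3 * n + 2.4) * (3 * n + 3.4) * (n + 0.4) * (n + 1.4)) := by gcongr
    _ ≤ _ := by
      -- The ratio tends to `16/27 < 3/4`; with this slack the expanded difference has only
      -- nonnegative coefficients in `n`.
      rw [div_le_iff₀ (by positivity), ← sub_nonneg]
      ring_nf
      positivity

theorem norm_wzF_zero_right_le (n : ℕ) : ‖wzF x y n 0‖ ≤ 25 / 4 * (3 / 4) ^ n := by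
  induction n with
  | zero => simpa using norm_wzF_zero_left_le hx hy 0
  | succ n ih =>
    calc _ ≤ _ := norm_wzF_succ_left_le hx hy n
      _ ≤ 3 / 4 * (25 / 4 * (3 / 4) ^ n) := by gcongr
      _ = _ := by ring

/-- Uniformity in `k` makes `G(n,k)` inherit the decay of `F(n,k)`; polynomial growth in `n` is
harmless against `(3/4)^n`. -/
theorem norm_wzCert_le (n k : ℕ) : ‖wzCert x y n k‖ ≤ 7 * (n + 1) ^ 2 := by
  have hn : (0 : ℝ) ≤ n := by positivity
  have hk : (0 : ℝ) ≤ k := by positivity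
  have hm := norm_half_sub_le hx hy
  have a1 : ‖(2 * n + 1 : ℂ)‖ = 2 * n + 1 := by
    rw [show (2 * n + 1 : ℂ) = ((2 * n + 1 : ℕ) : ℂ) by push_cast; ring, Complex.norm_natCast]
    push_cast; ring
  have a3 : ‖1 + (y - x) / 2 + 2 * n‖ ≤ 2 * n + 1.1 := by
    have := norm_add_le (2 * n + 1 : ℂ) ((y - x) / 2)
    rw [a1] at this
    rw [show 1 + (y - x) / 2 + 2 * n = 2 * n + 1 + (y - x) / 2 by ring]
    linarith
  have a5 : ‖y + n + k‖ ≤ n + k + 0.6 := by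
    have := norm_add_real_le hy (n + k)
    rw [abs_of_nonneg (by positivity)] at this
    push_cast at this; rw [← add_assoc] at this
    linarith
  have b1 : n + k + 0.6 ≤ ‖y + 3 * n + k + 1‖ := by
    have := le_norm_add_real hy (3 * n + k + 1)
    rw [abs_of_nonneg (by positivity)] at this
    push_cast at this; rw [← add_assoc, ← add_assoc] at this
    linarith
  have b2 : 1 ≤ ‖y + 3 * n + k + 2‖ := by
    have := le_norm_add_real hy (3 * n + k + 2)
    rw [abs_of_nonneg (by positivity)] at this
    push_cast at this; rw [← add_assoc, ← add_assoc] at this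
    linarith
  have b4 : 2 / 5 ≤ ‖1 - x + n - k‖ := by
    have := le_norm_add_real hx (k - n - 1)
    -- A half-integer has absolute value at least `1/2`.
    have h : (1 / 2 : ℝ) ≤ |(k - n - 1 : ℝ) + 1 / 2| := by
      rcases lt_or_ge n k with h | h
      · have : (n + 1 : ℝ) ≤ k := by exact_mod_cast h
        rw [abs_of_nonneg (by linarith)]; linarith
      · have : (k : ℝ) ≤ n := by exact_mod_cast h
        rw [abs_of_nonpos (by linarith)]; linarith
    push_cast at this
    rw [← norm_neg, show -(1 - x + n - k) = x + (k - n - 1) by ring]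
    linarith
  have q : ‖y + n + k‖ / ‖y + 3 * n + k + 1‖ ≤ 1 := div_le_one_of_le₀ (a5.trans b1) (norm_nonneg _)
  have t2 : ‖(y + n + k) / (2 * (y + 3 * n + k + 1))‖ ≤ 1 := by
    rw [norm_div, norm_mul, Complex.norm_ofNat, mul_comm, ← div_div]
    linarith
  have t3 : ‖(y + n + k) * (2 * n + 1) * (1 + (y - x) / 2 + 2 * n) /
      (2 * (1 - x + n - k) * (y + 3 * n + k + 1) * (y + 3 * n + k + 2))‖ ≤ 5 * (n + 1) ^ 2 := by
    rw [norm_div]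
    simp only [norm_mul]
    rw [a1, Complex.norm_ofNat]
    calc _ = (‖y + n + k‖ / ‖y + 3 * n + k + 1‖) * ((2 * n + 1) * ‖1 + (y - x) / 2 + 2 * n‖) /
          (2 * ‖1 - x + n - k‖ * ‖y + 3 * n + k + 2‖) := by
          rw [div_mul_eq_mul_div, div_div]; ring
      _ ≤ 1 * ((2 * n + 1) * (2 * n + 1.1)) / (2 * (2 / 5) * 1) := by gcongr
      _ ≤ _ := by
          rw [div_le_iff₀ (by norm_num)]
          nlinarith
  rw [wzCert]
  have h1 := norm_sub_le (1 - (y + n + k) / (2 * (y + 3 * n + k + 1)))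
    ((y + n + k) * (2 * n + 1) * (1 + (y - x) / 2 + 2 * n) /
      (2 * (1 - x + n - k) * (y + 3 * n + k + 1) * (y + 3 * n + k + 2)))
  have h2 := norm_sub_le 1 ((y + n + k) / (2 * (y + 3 * n + k + 1)))
  rw [norm_one] at h2
  nlinarith

theorem norm_wzG_le (n : ℕ) : ‖wzG x y n 0‖ ≤ 44 * ((n + 1) ^ 2 * (3 / 4) ^ n) := by
  rw [wzG, norm_mul]
  calc _ ≤ 25 / 4 * (3 / 4) ^ n * (7 * (n + 1 : ℝ) ^ 2) :=
        mul_le_mul (norm_wzF_zero_right_le hx hy n) (norm_wzCert_le hx hy n 0) (norm_nonneg _)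
          (by positivity)
    _ ≤ _ := by nlinarith [show (0 : ℝ) ≤ (n + 1) ^ 2 * (3 / 4) ^ n by positivity]

omit hx hy in
theorem summable_wzG_bound : Summable fun n : ℕ => 44 * (((n : ℝ) + 1) ^ 2 * (3 / 4) ^ n) := by
  have h := (summable_nat_add_iff 1).2
    (summable_pow_mul_geometric_of_norm_lt_one 2 (r := (3 / 4 : ℝ)) (by norm_num))
  refine (h.mul_left (44 * (4 / 3))).congr fun n => ?_
  push_cast; ring

omit hx hy in
theorem summable_wzF_bound : Summable fun k : ℕ => 25 / 4 * (1 / ((k : ℝ) + 1) ^ 2) := by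
  have h := (summable_nat_add_iff 1).2 (Real.summable_one_div_nat_pow.2 one_lt_two)
  refine (h.mul_left (25 / 4)).congr fun n => ?_
  push_cast; ring

theorem tendsto_wzF_atTop (n : ℕ) : Tendsto (fun k => wzF x y n k) atTop (𝓝 0) := by
  rcases Nat.eq_zero_or_pos n with rfl | hn
  · exact squeeze_zero_norm (norm_wzF_zero_left_le hx hy) summable_wzF_bound.tendsto_atTop_zero
  · have h : Summable fun k => ‖wzF x y n k‖ :=
      summable_of_sum_range_le (fun _ => norm_nonneg _) (sum_norm_wzF_le hx hy hn)
    exact tendsto_zero_iff_norm_tendsto_zero.2 h.tendsto_atTop_zero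

theorem tendsto_wzG_atTop (n : ℕ) : Tendsto (fun k => wzG x y n k) atTop (𝓝 0) := by
  have h := (tendsto_wzF_atTop hx hy n).norm.mul_const (7 * ((n : ℝ) + 1) ^ 2)
  rw [norm_zero, zero_mul] at h
  refine squeeze_zero_norm (fun k => ?_) h
  rw [wzG, norm_mul]
  exact mul_le_mul_of_nonneg_left (norm_wzCert_le hx hy n k) (norm_nonneg _)

/-- Let `K → ∞` with `N` fixed: the edge of `G` at `k = K` has finitely many terms, each tending to
0, so only the edge of `F` at `n = N` remains. -/
theorem norm_sum_wzG_sub_tsum_wzF_le {N : ℕ} (hN : 1 ≤ N) :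
    ‖∑ n ∈ range N, wzG x y n 0 - ∑' k, wzF x y 0 k‖ ≤ ‖wzF x y N 0‖ * (N + 2) := by
  have hs : Summable fun k => wzF x y 0 k :=
    .of_norm_bounded summable_wzF_bound (norm_wzF_zero_left_le hx hy)
  have h1 : Tendsto (fun K => ‖∑ n ∈ range N, wzG x y n 0 - ∑ k ∈ range K, wzF x y 0 k‖) atTop
      (𝓝 ‖∑ n ∈ range N, wzG x y n 0 - ∑' k, wzF x y 0 k‖) :=
    (tendsto_const_nhds.sub hs.hasSum.tendsto_sum_nat).norm
  have h2 : Tendsto (fun K => ‖∑ n ∈ range N, wzG x y n K‖ + ‖wzF x y N 0‖ * (N + 2)) atTop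
      (𝓝 (‖wzF x y N 0‖ * (N + 2))) := by
    have := (tendsto_finsetSum (range N) fun n _ => tendsto_wzG_atTop hx hy n).norm.add_const
      (‖wzF x y N 0‖ * (N + 2))
    simpa using this
  refine le_of_tendsto_of_tendsto' h1 h2 fun K => ?_
  rw [sum_wzG_sub_sum_wzF (add_int_ne_zero hx) (add_nat_ne_zero hy)]
  refine (norm_sub_le _ _).trans ?_
  gcongr
  exact (norm_sum_le _ _).trans (sum_norm_wzF_le hx hy hN K)

theorem hasSum_wzG : HasSum (fun n => wzG x y n 0) (∑' k, wzF x y 0 k) := by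
  have hs : Summable fun n => wzG x y n 0 :=
    .of_norm_bounded summable_wzG_bound (norm_wzG_le hx hy)
  rw [hs.hasSum_iff_tendsto_nat, tendsto_iff_norm_sub_tendsto_zero]
  have hb : Tendsto (fun N : ℕ => 44 * (((N : ℝ) + 1) ^ 2 * (3 / 4) ^ N)) atTop (𝓝 0) :=
    summable_wzG_bound.tendsto_atTop_zero
  refine squeeze_zero' (Eventually.of_forall fun _ => norm_nonneg _) ?_ hb
  filter_upwards [eventually_ge_atTop 1] with N hN
  have hN' : (1 : ℝ) ≤ N := by exact_mod_cast hN
  calc _ ≤ _ := norm_sum_wzG_sub_tsum_wzF_le hx hy hN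
    _ ≤ 25 / 4 * (3 / 4) ^ N * (N + 2) := by gcongr; exact norm_wzF_zero_right_le hx hy N
    _ = (25 / 4 * (N + 2)) * (3 / 4) ^ N := by ring
    _ ≤ (44 * (N + 1) ^ 2) * (3 / 4) ^ N := by gcongr ?_ * _; nlinarith
    _ = _ := by ring

end bounds

/-! ### Differentiation along `x = 1/2 + 7e`, `y = 1/2 - 5e` -/

theorem Differentiable.rising {f : ℂ → ℂ} (hf : Differentiable ℂ f) (m : ℕ) :
    Differentiable ℂ fun e => rising (f e) m :=
  Differentiable.fun_finsetProd fun _ _ => hf.add_const _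

theorem HasDerivAt.rising {f : ℂ → ℂ} {f' z : ℂ} (hf : HasDerivAt f f' z) {m : ℕ}
    (h : ∀ j < m, f z + j ≠ 0) :
    HasDerivAt (fun e => rising (f e) m)
      (rising (f z) m * (f' * ∑ j ∈ range m, 1 / (f z + j))) z := by
  induction m with
  | zero => simpa [rising_zero] using hasDerivAt_const z (1 : ℂ)
  | succ m ih =>
    have hm : f z + m ≠ 0 := h m (Nat.lt_succ_self m)
    have := (ih fun j hj => h j (hj.trans (Nat.lt_succ_self m))).mul (hf.add_const (m : ℂ))
    simp only [rising_succ]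
    refine this.congr_deriv ?_
    rw [sum_range_succ]
    field_simp

theorem norm_half_add_mul_sub_le {e : ℂ} (he : ‖e‖ < 1 / 100) {c : ℂ} (hc : ‖c‖ ≤ 10) :
    ‖1 / 2 + c * e - 1 / 2‖ ≤ 1 / 10 := by
  rw [add_sub_cancel_left, norm_mul]
  nlinarith [norm_nonneg e, norm_nonneg c]

theorem differentiableAt_wzF {e : ℂ} (hx : ‖1 / 2 + 7 * e - 1 / 2‖ ≤ 1 / 10)
    (hy : ‖1 / 2 + -5 * e - 1 / 2‖ ≤ 1 / 10) (n k : ℕ) :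
    DifferentiableAt ℂ (fun e : ℂ => wzF (1 / 2 + 7 * e) (1 / 2 + -5 * e) n k) e := by
  refine DifferentiableAt.fun_div ?_ ?_ ?_
  · refine DifferentiableAt.mul (by fun_prop) ?_
    exact (Differentiable.rising (by fun_prop) _) e
  · refine DifferentiableAt.mul ?_ ?_
    · exact (Differentiable.rising (f := fun e : ℂ => 1 / 2 + -5 * e + n + k) (by fun_prop) _) e
    · exact (Differentiable.rising (f := fun e : ℂ => 1 / 2 + 7 * e + k - n) (by fun_prop) _) e
  · refine mul_ne_zero (rising_ne_zero fun j _ => ?_) (rising_ne_zero fun j _ => ?_)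
    · simpa [add_assoc] using add_nat_ne_zero hy (n + (k + j))
    · have := add_int_ne_zero hx (k - n + j); push_cast at this
      intro h; exact this (by rw [← h]; ring)

theorem differentiableAt_wzCert {e : ℂ} (hx : ‖1 / 2 + 7 * e - 1 / 2‖ ≤ 1 / 10)
    (hy : ‖1 / 2 + -5 * e - 1 / 2‖ ≤ 1 / 10) (n k : ℕ) :
    DifferentiableAt ℂ (fun e : ℂ => wzCert (1 / 2 + 7 * e) (1 / 2 + -5 * e) n k) e := by
  have h1 : 1 / 2 + -5 * e + 3 * n + k + 1 ≠ 0 := by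
    have := add_nat_ne_zero hy (3 * n + k + 1); push_cast at this
    intro h; exact this (by rw [← h]; ring)
  have h2 : 1 / 2 + -5 * e + 3 * n + k + 2 ≠ 0 := by
    have := add_nat_ne_zero hy (3 * n + k + 2); push_cast at this
    intro h; exact this (by rw [← h]; ring)
  have h3 : 1 - (1 / 2 + 7 * e) + n - k ≠ 0 := by
    have := add_int_ne_zero hx (k - n - 1); push_cast at this
    intro h; exact this (by rw [← neg_eq_zero, ← h]; ring)
  refine DifferentiableAt.sub (DifferentiableAt.sub (by fun_prop) ?_) ?_
  · exact DifferentiableAt.fun_div (by fun_prop) (by fun_prop) (mul_ne_zero two_ne_zero h1)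
  · exact DifferentiableAt.fun_div (by fun_prop) (by fun_prop)
      (mul_ne_zero (mul_ne_zero (mul_ne_zero two_ne_zero h3) h1) h2)

/-- The bounds are uniform on a complex disc, so holomorphy allows termwise differentiation with no
estimate on derivatives. -/
theorem hasSum_deriv_wzG :
    HasSum (fun n => deriv (fun e : ℂ => wzG (1 / 2 + 7 * e) (1 / 2 + -5 * e) n 0) 0)
      (∑' k, deriv (fun e : ℂ => wzF (1 / 2 + 7 * e) (1 / 2 + -5 * e) 0 k) 0) := by
  have hU : IsOpen (Metric.ball (0 : ℂ) (1 / 100)) := Metric.isOpen_ball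
  have h0 : (0 : ℂ) ∈ Metric.ball (0 : ℂ) (1 / 100) := Metric.mem_ball_self (by norm_num)
  have hx : ∀ e ∈ Metric.ball (0 : ℂ) (1 / 100), ‖1 / 2 + 7 * e - 1 / 2‖ ≤ 1 / 10 :=
    fun e he => norm_half_add_mul_sub_le (mem_ball_zero_iff.1 he) (by norm_num)
  have hy : ∀ e ∈ Metric.ball (0 : ℂ) (1 / 100), ‖1 / 2 + -5 * e - 1 / 2‖ ≤ 1 / 10 :=
    fun e he => norm_half_add_mul_sub_le (mem_ball_zero_iff.1 he) (by norm_num)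
  have hG := Complex.hasSum_deriv_of_summable_norm (z := 0)
    (F := fun n (e : ℂ) => wzG (1 / 2 + 7 * e) (1 / 2 + -5 * e) n 0) summable_wzG_bound
    (fun n e he => ((differentiableAt_wzF (hx e he) (hy e he) n 0).mul
      (differentiableAt_wzCert (hx e he) (hy e he) n 0)).differentiableWithinAt) hU
    (fun n e he => norm_wzG_le (hx e he) (hy e he) n) h0
  have hF := Complex.hasSum_deriv_of_summable_norm (z := 0)
    (F := fun k (e : ℂ) => wzF (1 / 2 + 7 * e) (1 / 2 + -5 * e) 0 k) summable_wzF_bound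
    (fun k e he => (differentiableAt_wzF (hx e he) (hy e he) 0 k).differentiableWithinAt) hU
    (fun k e he => norm_wzF_zero_left_le (hx e he) (hy e he) k) h0
  have heq : (fun e : ℂ => ∑' k, wzF (1 / 2 + 7 * e) (1 / 2 + -5 * e) 0 k) =ᶠ[nhds 0]
      fun e => ∑' n, wzG (1 / 2 + 7 * e) (1 / 2 + -5 * e) n 0 := by
    filter_upwards [hU.mem_nhds h0] with e he
    exact (hasSum_wzG (hx e he) (hy e he)).tsum_eq.symm
  rw [hF.tsum_eq, heq.deriv_eq]
  exact hG

theorem deriv_wzF_zero_left (k : ℕ) :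
    deriv (fun e : ℂ => wzF (1 / 2 + 7 * e) (1 / 2 + -5 * e) 0 k) 0 =
      -16 * ((-1) ^ k / (2 * k + 1) ^ 3) := by
  simp only [wzF_zero_left]
  have hk : (2 * k + 1 : ℂ) ≠ 0 := by exact_mod_cast Nat.succ_ne_zero (2 * k)
  have hk' : (1 / 2 + k : ℂ) ≠ 0 := by
    intro h; exact hk (by linear_combination 2 * h)
  have h1 : HasDerivAt (fun e : ℂ => 1 / 2 + 7 * e + k) 7 0 := by
    simpa using (((hasDerivAt_id (0 : ℂ)).const_mul 7).const_add (1 / 2)).add_const (k : ℂ)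
  have h2 : HasDerivAt (fun e : ℂ => 1 / 2 + -5 * e + k) (-5) 0 := by
    simpa using (((hasDerivAt_id (0 : ℂ)).const_mul (-5)).const_add (1 / 2)).add_const (k : ℂ)
  have h3 := (hasDerivAt_const (0 : ℂ) ((-1 : ℂ) ^ k)).fun_div (h1.fun_mul h2)
    (by simpa using hk')
  rw [h3.deriv]
  simp only [mul_zero, add_zero]
  have e : (1 / 2 + k : ℂ) = (2 * k + 1) / 2 := by ring
  rw [e]
  field_simp
  ring

/-- The value of the L-function modulo 4 at 3; its even-indexed terms vanish. -/
theorem hasSum_neg_one_pow_div_odd_pow_three :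
    HasSum (fun k : ℕ => (-1 : ℝ) ^ k / (2 * k + 1) ^ 3) (Real.pi ^ 3 / 32) := by
  have h := hasSum_L_function_mod_four_eval_three
  have hinj : Function.Injective fun k : ℕ => 2 * k + 1 := fun a b hab => by
    simpa using hab
  rw [← hinj.hasSum_iff] at h
  · convert h using 1
    funext k
    have e : Real.pi * ((2 * k + 1 : ℕ) : ℝ) / 2 = k * Real.pi + Real.pi / 2 := by push_cast; ring
    rw [Function.comp_apply, e, Real.sin_add_pi_div_two, Real.cos_nat_mul_pi]
    push_cast
    ring
  · intro m hm
    obtain ⟨k, rfl | rfl⟩ := m.even_or_odd'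
    · have e : Real.pi * ((2 * k : ℕ) : ℝ) / 2 = k * Real.pi := by push_cast; ring
      rw [e, Real.sin_nat_mul_pi, mul_zero]
    · exact absurd ⟨k, rfl⟩ hm

theorem hasDerivAt_wzF_zero_right (n : ℕ) :
    HasDerivAt (fun e : ℂ => wzF (1 / 2 + 7 * e) (1 / 2 + -5 * e) n 0)
      (wzF (1 / 2) (1 / 2) n 0 * (-6 * ∑ j ∈ range (2 * n), 1 / (1 + (j : ℂ)) +
        5 * ∑ j ∈ range (2 * n + 1), 1 / (1 / 2 + n + (j : ℂ)) -
        7 * ∑ j ∈ range (2 * n + 1), 1 / (1 / 2 - n + (j : ℂ)))) 0 := by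
  have hz : ‖(1 / 2 : ℂ) - 1 / 2‖ ≤ 1 / 10 := by norm_num
  have hA : ∀ j < 2 * n + 1, (1 / 2 + n + j : ℂ) ≠ 0 := fun j _ => by
    simpa [add_assoc] using add_nat_ne_zero hz (n + j)
  have hB : ∀ j < 2 * n + 1, (1 / 2 - n + j : ℂ) ≠ 0 := fun j _ => by
    have := add_int_ne_zero hz (-n + j); push_cast at this
    intro h; exact this (by rw [← h]; ring)
  have hC : ∀ j < 2 * n, (1 + j : ℂ) ≠ 0 := fun j _ => by
    rw [add_comm]; exact Nat.cast_add_one_ne_zero j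
  have d1 : HasDerivAt (fun e : ℂ => 1 + (1 / 2 + -5 * e - (1 / 2 + 7 * e)) / 2) (-6) 0 := by
    have := ((hasDerivAt_id (0 : ℂ)).const_mul (-6)).const_add 1
    rw [mul_one] at this
    refine this.congr_of_eventuallyEq (.of_forall fun e => ?_)
    simp only [id]; ring
  have d2 : HasDerivAt (fun e : ℂ => 1 / 2 + -5 * e + n + ((0 : ℕ) : ℂ)) (-5) 0 := by
    have := ((hasDerivAt_id (0 : ℂ)).const_mul (-5)).const_add (1 / 2 + n : ℂ)
    rw [mul_one] at this
    refine this.congr_of_eventuallyEq (.of_forall fun e => ?_)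
    simp only [id, Nat.cast_zero]; ring
  have d3 : HasDerivAt (fun e : ℂ => 1 / 2 + 7 * e + ((0 : ℕ) : ℂ) - n) 7 0 := by
    have := ((hasDerivAt_id (0 : ℂ)).const_mul 7).const_add (1 / 2 - n : ℂ)
    rw [mul_one] at this
    refine this.congr_of_eventuallyEq (.of_forall fun e => ?_)
    simp only [id, Nat.cast_zero]; ring
  have r1 := d1.rising (m := 2 * n) (fun j hj => by simpa using hC j hj)
  have r2 := d2.rising (m := 2 * n + 1) (fun j hj => by simpa using hA j hj)
  have r3 := d3.rising (m := 2 * n + 1) (fun j hj => by simpa using hB j hj)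
  have nA := rising_ne_zero hA
  have nB := rising_ne_zero hB
  have r := (r1.const_mul ((-1) ^ (n + 0) * ((2 * n).factorial : ℂ))).fun_div (r2.fun_mul r3)
    (by simpa using ⟨by simpa using nA, by simpa using nB⟩)
  refine r.congr_deriv ?_
  rw [wzF]
  simp only [mul_zero, add_zero, Nat.cast_zero, sub_self, zero_div]
  field_simp
  ring

theorem hasDerivAt_wzCert_zero_right (n : ℕ) :
    HasDerivAt (fun e : ℂ => wzCert (1 / 2 + 7 * e) (1 / 2 + -5 * e) n 0)
      (10 / (9 * (2 * n + 1)) - 2 * (2 * n + 1) / (3 * (6 * n + 5)) *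
        (4 / (3 * (2 * n + 1)) + 10 / (6 * n + 5))) 0 := by
  have h1 : (2 * n + 1 : ℂ) ≠ 0 := by exact_mod_cast Nat.succ_ne_zero (2 * n)
  have h2 : (6 * n + 5 : ℂ) ≠ 0 := by exact_mod_cast Nat.succ_ne_zero (6 * n + 4)
  have dA : HasDerivAt (fun e : ℂ => 1 / 2 + -5 * e + n + ((0 : ℕ) : ℂ)) (-5) 0 := by
    have := ((hasDerivAt_id (0 : ℂ)).const_mul (-5)).const_add (1 / 2 + n : ℂ)
    rw [mul_one] at this
    refine this.congr_of_eventuallyEq (.of_forall fun e => ?_)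
    simp only [id, Nat.cast_zero]; ring
  have dB : HasDerivAt (fun e : ℂ => 1 / 2 + -5 * e + 3 * n + ((0 : ℕ) : ℂ) + 1) (-5) 0 := by
    have := ((hasDerivAt_id (0 : ℂ)).const_mul (-5)).const_add (1 / 2 + 3 * n + 1 : ℂ)
    rw [mul_one] at this
    refine this.congr_of_eventuallyEq (.of_forall fun e => ?_)
    simp only [id, Nat.cast_zero]; ring
  have dC : HasDerivAt (fun e : ℂ => 1 / 2 + -5 * e + 3 * n + ((0 : ℕ) : ℂ) + 2) (-5) 0 := by
    have := ((hasDerivAt_id (0 : ℂ)).const_mul (-5)).const_add (1 / 2 + 3 * n + 2 : ℂ)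
    rw [mul_one] at this
    refine this.congr_of_eventuallyEq (.of_forall fun e => ?_)
    simp only [id, Nat.cast_zero]; ring
  have dK : HasDerivAt (fun e : ℂ => 1 - (1 / 2 + 7 * e) + n - ((0 : ℕ) : ℂ)) (-7) 0 := by
    have := ((hasDerivAt_id (0 : ℂ)).const_mul (-7)).const_add (1 / 2 + n : ℂ)
    rw [mul_one] at this
    refine this.congr_of_eventuallyEq (.of_forall fun e => ?_)
    simp only [id, Nat.cast_zero]; ring
  have dM : HasDerivAt
      (fun e : ℂ => 1 + (1 / 2 + -5 * e - (1 / 2 + 7 * e)) / 2 + 2 * (n : ℂ)) (-6) 0 := by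
    have := ((hasDerivAt_id (0 : ℂ)).const_mul (-6)).const_add (1 + 2 * n : ℂ)
    rw [mul_one] at this
    refine this.congr_of_eventuallyEq (.of_forall fun e => ?_)
    simp only [id]; ring
  have eA : (1 / 2 + -5 * 0 + n + ((0 : ℕ) : ℂ) : ℂ) = (2 * n + 1) / 2 := by push_cast; ring
  have eB : (1 / 2 + -5 * 0 + 3 * n + ((0 : ℕ) : ℂ) + 1 : ℂ) = 3 * (2 * n + 1) / 2 := by
    push_cast; ring
  have eC : (1 / 2 + -5 * 0 + 3 * n + ((0 : ℕ) : ℂ) + 2 : ℂ) = (6 * n + 5) / 2 := by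
    push_cast; ring
  have eK : (1 - (1 / 2 + 7 * 0) + n - ((0 : ℕ) : ℂ) : ℂ) = (2 * n + 1) / 2 := by push_cast; ring
  have eM : (1 + (1 / 2 + -5 * 0 - (1 / 2 + 7 * 0)) / 2 + 2 * n : ℂ) = 2 * n + 1 := by ring
  have r := ((hasDerivAt_const (0 : ℂ) (1 : ℂ)).fun_sub
    (dA.fun_div (dB.const_mul 2) (by rw [eB]; simpa using h1))).fun_sub
    (((dA.mul_const (2 * n + 1 : ℂ)).fun_mul dM).fun_div
      (((dK.const_mul 2).fun_mul dB).fun_mul dC) (by rw [eB, eC, eK]; simpa using ⟨h1, h2⟩))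
  refine r.congr_deriv ?_
  -- Linear forms become atoms for `field_simp`; this relation links them again before `ring`.
  have e5 : (6 * n + 5 : ℂ) = 3 * (2 * n + 1) + 2 := by ring
  rw [eA, eB, eC, eK, eM]
  generalize (2 * n + 1 : ℂ) = s at *
  generalize (6 * n + 5 : ℂ) = t at *
  field_simp
  rw [e5]
  ring

/-! ### The logarithmic derivative in harmonic numbers -/

theorem sum_one_div_half_add (m : ℕ) :
    ∑ j ∈ range m, 1 / (1 / 2 + (j : ℂ)) = 2 * (harmonic (2 * m) : ℂ) - (harmonic m : ℂ) := by
  induction m with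
  | zero => simp
  | succ m ih =>
    have h1 : (2 * m + 1 : ℂ) ≠ 0 := by exact_mod_cast Nat.succ_ne_zero (2 * m)
    have h2 : (m + 1 : ℂ) ≠ 0 := Nat.cast_add_one_ne_zero m
    have e1 : (1 / 2 + m : ℂ) = (2 * m + 1) / 2 := by ring
    have e2 : (2 * m + 1 + 1 : ℂ) = 2 * (m + 1) := by ring
    rw [sum_range_succ, ih, show 2 * (m + 1) = 2 * m + 1 + 1 by ring, harmonic_succ, harmonic_succ,
      harmonic_succ]
    push_cast
    rw [e1, e2]
    field_simp
    ring

theorem sum_one_div_one_add (m : ℕ) :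
    ∑ j ∈ range m, 1 / (1 + (j : ℂ)) = (harmonic m : ℂ) := by
  rw [harmonic]
  push_cast
  exact sum_congr rfl fun j _ => by rw [one_div, add_comm]

theorem sum_one_div_half_add_add (n : ℕ) :
    ∑ j ∈ range (2 * n + 1), 1 / (1 / 2 + n + (j : ℂ)) =
      2 * (harmonic (6 * n + 2) : ℂ) - harmonic (3 * n + 1) - 2 * harmonic (2 * n) + harmonic n := by
  have h := sum_range_add (fun j : ℕ => 1 / (1 / 2 + (j : ℂ))) n (2 * n + 1)
  rw [show n + (2 * n + 1) = 3 * n + 1 by ring, sum_one_div_half_add, sum_one_div_half_add,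
    show 2 * (3 * n + 1) = 6 * n + 2 by ring] at h
  push_cast at h
  simp only [← add_assoc] at h
  linear_combination -h

/-- The terms run over the half-integers from `1/2 - n` to `1/2 + n` and cancel in pairs, except the
last. So the slope of `x` adds no harmonic number here. -/
theorem sum_one_div_half_sub_add (n : ℕ) :
    ∑ j ∈ range (2 * n + 1), 1 / (1 / 2 - n + (j : ℂ)) = 2 / (2 * n + 1) := by
  induction n with
  | zero => norm_num
  | succ n ih =>
    have h1 : (2 * n + 1 : ℂ) ≠ 0 := by exact_mod_cast Nat.succ_ne_zero (2 * n)
    have h2 : (2 * n + 3 : ℂ) ≠ 0 := by exact_mod_cast Nat.succ_ne_zero (2 * n + 2)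
    have e : ∀ j : ℕ, 1 / 2 - ((n + 1 : ℕ) : ℂ) + ((j + 1 : ℕ) : ℂ) = 1 / 2 - n + j := fun j => by
      push_cast; ring
    have e1 : 1 / 2 - ((n + 1 : ℕ) : ℂ) + ((0 : ℕ) : ℂ) = -(2 * n + 1) / 2 := by
      push_cast; ring
    have e2 : 1 / 2 - (n : ℂ) + ((2 * n + 1 : ℕ) : ℂ) = (2 * n + 3) / 2 := by
      push_cast; ring
    have e3 : 2 * ((n + 1 : ℕ) : ℂ) + 1 = 2 * n + 3 := by push_cast; ring
    rw [show 2 * (n + 1) + 1 = 2 * n + 1 + 1 + 1 by ring, sum_range_succ']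
    simp only [e]
    rw [sum_range_succ, ih, e1, e2, e3]
    field_simp
    ring

theorem logDeriv_wzF_eq (n : ℕ) :
    -6 * ∑ j ∈ range (2 * n), 1 / (1 + (j : ℂ)) +
        5 * ∑ j ∈ range (2 * n + 1), 1 / (1 / 2 + n + (j : ℂ)) -
        7 * ∑ j ∈ range (2 * n + 1), 1 / (1 / 2 - n + (j : ℂ)) =
      (harmonicCombination (n + 1) : ℂ) - 10 / (6 * n + 5) - 4 / (3 * (2 * n + 1)) := by
  have h1 : (2 * n + 1 : ℂ) ≠ 0 := by exact_mod_cast Nat.succ_ne_zero (2 * n)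
  have h2 : (3 * n + 2 : ℂ) ≠ 0 := by exact_mod_cast Nat.succ_ne_zero (3 * n + 1)
  have h3 : (6 * n + 5 : ℂ) ≠ 0 := by exact_mod_cast Nat.succ_ne_zero (6 * n + 4)
  have e1 : (6 * n + 2 + 1 : ℂ) = 3 * (2 * n + 1) := by ring
  have e2 : (6 * n + 2 + 1 + 1 : ℂ) = 2 * (3 * n + 2) := by ring
  have e3 : (6 * n + 2 + 1 + 1 + 1 : ℂ) = 6 * n + 5 := by ring
  have e4 : (3 * n + 1 + 1 : ℂ) = 3 * n + 2 := by ring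
  rw [sum_one_div_one_add, sum_one_div_half_add_add, sum_one_div_half_sub_add, harmonicCombination,
    show 6 * (n + 1) - 1 = 6 * n + 2 + 1 + 1 + 1 by omega, show 3 * (n + 1) - 1 = 3 * n + 1 + 1 by omega,
    show 2 * (n + 1) - 1 = 2 * n + 1 by omega, Nat.add_sub_cancel,
    harmonic_succ (6 * n + 2 + 1 + 1), harmonic_succ (6 * n + 2 + 1), harmonic_succ (6 * n + 2),
    harmonic_succ (3 * n + 1), harmonic_succ (2 * n)]
  push_cast
  rw [e3, e2, e1, e4]
  generalize (2 * n + 1 : ℂ) = s at *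
  generalize (3 * n + 2 : ℂ) = t at *
  generalize (6 * n + 5 : ℂ) = u at *
  field_simp
  ring

/-! ### Closed form at `x = y = 1/2` and identification of the summand -/

theorem wzF_half_mul_factorial (n : ℕ) :
    wzF (1 / 2) (1 / 2) n 0 * ((2 * n + 1) * (n + 1) ^ 2 * (6 * n + 6).factorial) * 32 =
      6 * (6 * n + 5) * 256 ^ (n + 1) *
        ((n + 1).factorial * (2 * n + 2).factorial * (3 * n + 3).factorial) := by
  induction n with
  | zero => norm_num [wzF_zero_left, Nat.factorial]
  | succ n ih =>
    have hz : ‖(1 / 2 : ℂ) - 1 / 2‖ ≤ 1 / 10 := by norm_num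
    have h1 : (2 * n + 1 : ℂ) ≠ 0 := by exact_mod_cast Nat.succ_ne_zero (2 * n)
    have h3 : (2 * n + 3 : ℂ) ≠ 0 := by exact_mod_cast Nat.succ_ne_zero (2 * n + 2)
    have h5 : (6 * n + 5 : ℂ) ≠ 0 := by exact_mod_cast Nat.succ_ne_zero (6 * n + 4)
    have h7 : (6 * n + 7 : ℂ) ≠ 0 := by exact_mod_cast Nat.succ_ne_zero (6 * n + 6)
    have h0 : (n + 1 : ℂ) ≠ 0 := Nat.cast_add_one_ne_zero n
    have hF : wzF (1 / 2) (1 / 2) (n + 1) 0 * (3 * (6 * n + 5) * (6 * n + 7) * (2 * n + 3)) =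
        64 * (2 * n + 1) * (n + 1) ^ 2 * wzF (1 / 2) (1 / 2) n 0 := by
      have d1 : (1 / 2 + 3 * n + ((0 : ℕ) : ℂ) + 1 : ℂ) = 3 * (2 * n + 1) / 2 := by push_cast; ring
      have d2 : (1 / 2 + 3 * n + ((0 : ℕ) : ℂ) + 2 : ℂ) = (6 * n + 5) / 2 := by push_cast; ring
      have d3 : (1 / 2 + 3 * n + ((0 : ℕ) : ℂ) + 3 : ℂ) = (6 * n + 7) / 2 := by push_cast; ring
      have d4 : (1 / 2 + ((0 : ℕ) : ℂ) - n - 1 : ℂ) = -(2 * n + 1) / 2 := by push_cast; ring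
      have d5 : (1 / 2 + ((0 : ℕ) : ℂ) + n + 1 : ℂ) = (2 * n + 3) / 2 := by push_cast; ring
      rw [wzF_succ_left (add_int_ne_zero hz) (add_nat_ne_zero hz), d1, d2, d3, d4, d5]
      generalize wzF (1 / 2) (1 / 2) n 0 = W
      rw [sub_self, zero_div, add_zero, Nat.cast_zero]
      clear d1 d2 d3 d4 d5 ih
      generalize hs : (2 * n + 1 : ℂ) = s at *
      generalize ht : (6 * n + 5 : ℂ) = t at *
      generalize hu : (6 * n + 7 : ℂ) = u at *
      generalize hv : (2 * n + 3 : ℂ) = v at *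
      field_simp
      subst hs
      ring
    have f1 : ((6 * (n + 1) + 6).factorial : ℂ) = (6 * n + 12) * (6 * n + 11) * (6 * n + 10) *
        (6 * n + 9) * (6 * n + 8) * (6 * n + 7) * (6 * n + 6).factorial := by
      rw [show 6 * (n + 1) + 6 = 6 * n + 6 + 1 + 1 + 1 + 1 + 1 + 1 by ring]
      rw [Nat.factorial_succ (6 * n + 6 + 1 + 1 + 1 + 1 + 1),
        Nat.factorial_succ (6 * n + 6 + 1 + 1 + 1 + 1), Nat.factorial_succ (6 * n + 6 + 1 + 1 + 1),
        Nat.factorial_succ (6 * n + 6 + 1 + 1), Nat.factorial_succ (6 * n + 6 + 1),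
        Nat.factorial_succ (6 * n + 6)]
      push_cast; ring
    have f2 : ((2 * (n + 1) + 2).factorial : ℂ) =
        (2 * n + 4) * (2 * n + 3) * (2 * n + 2).factorial := by
      rw [show 2 * (n + 1) + 2 = 2 * n + 2 + 1 + 1 by ring, Nat.factorial_succ (2 * n + 2 + 1),
        Nat.factorial_succ (2 * n + 2)]
      push_cast; ring
    have f3 : ((3 * (n + 1) + 3).factorial : ℂ) =
        (3 * n + 6) * (3 * n + 5) * (3 * n + 4) * (3 * n + 3).factorial := by
      rw [show 3 * (n + 1) + 3 = 3 * n + 3 + 1 + 1 + 1 by ring,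
        Nat.factorial_succ (3 * n + 3 + 1 + 1), Nat.factorial_succ (3 * n + 3 + 1),
        Nat.factorial_succ (3 * n + 3)]
      push_cast; ring
    have f4 : ((n + 1 + 1).factorial : ℂ) = (n + 2) * (n + 1).factorial := by
      rw [Nat.factorial_succ (n + 1)]
      push_cast; ring
    rw [f1, f2, f3, f4]
    -- This factor is the denominator of the ratio in `hF`.
    refine mul_right_cancel₀ (mul_ne_zero (mul_ne_zero (mul_ne_zero (three_ne_zero) h5) h7) h3) ?_
    push_cast
    generalize wzF (1 / 2) (1 / 2) (n + 1) 0 = W at *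
    generalize wzF (1 / 2) (1 / 2) n 0 = V at *
    generalize ((6 * n + 6).factorial : ℂ) = a at *
    generalize ((n + 1).factorial : ℂ) = b at *
    generalize ((2 * n + 2).factorial : ℂ) = c at *
    generalize ((3 * n + 3).factorial : ℂ) = d at *
    linear_combination (2 * (n + 1 : ℂ) + 1) * (n + 1 + 1) ^ 2 * ((6 * n + 12) * (6 * n + 11) *
      (6 * n + 10) * (6 * n + 9) * (6 * n + 8) * (6 * n + 7) * a) * 32 * hF +
      64 * (2 * (n + 1 : ℂ) + 1) * (n + 1 + 1) ^ 2 * ((6 * n + 12) * (6 * n + 11) *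
      (6 * n + 10) * (6 * n + 9) * (6 * n + 8) * (6 * n + 7)) * ih

/-- With `k = n + 1`, the two binomials multiply to `(6k)! / (k! (2k)! (3k)!)`. -/
theorem wzF_half_eq (n : ℕ) :
    wzF (1 / 2) (1 / 2) n 0 * 32 = 6 * (6 * n + 5) * (256 ^ (n + 1) /
      ((2 * n + 1) * (n + 1) ^ 2 * (Nat.choose (3 * (n + 1)) (n + 1) : ℂ) *
        (Nat.choose (6 * (n + 1)) (3 * (n + 1)) : ℂ))) := by
  have h1 : (2 * n + 1 : ℂ) ≠ 0 := by exact_mod_cast Nat.succ_ne_zero (2 * n)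
  have h0 : (n + 1 : ℂ) ≠ 0 := Nat.cast_add_one_ne_zero n
  have hc1 := Nat.add_choose_mul_factorial_mul_factorial (2 * n + 2) (n + 1)
  have hc2 := Nat.add_choose_mul_factorial_mul_factorial (3 * n + 3) (3 * n + 3)
  rw [show 2 * n + 2 + (n + 1) = 3 * n + 3 by ring] at hc1
  rw [show 3 * n + 3 + (3 * n + 3) = 6 * n + 6 by ring] at hc2
  have hC1 : (Nat.choose (3 * n + 3) (n + 1) : ℂ) ≠ 0 :=
    Nat.cast_ne_zero.2 (Nat.choose_pos (by omega)).ne'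
  have hC2 : (Nat.choose (6 * n + 6) (3 * n + 3) : ℂ) ≠ 0 :=
    Nat.cast_ne_zero.2 (Nat.choose_pos (by omega)).ne'
  have hf1 : ((n + 1).factorial : ℂ) ≠ 0 := Nat.cast_ne_zero.2 (Nat.factorial_ne_zero _)
  have hf2 : ((2 * n + 2).factorial : ℂ) ≠ 0 := Nat.cast_ne_zero.2 (Nat.factorial_ne_zero _)
  have hf3 : ((3 * n + 3).factorial : ℂ) ≠ 0 := Nat.cast_ne_zero.2 (Nat.factorial_ne_zero _)
  have h := wzF_half_mul_factorial n
  rw [← hc2] at h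
  nth_rewrite 1 [← hc1] at h
  push_cast at h
  rw [show 3 * (n + 1) = 3 * n + 3 by ring, show 6 * (n + 1) = 6 * n + 6 by ring, ← mul_div_assoc,
    eq_div_iff (mul_ne_zero (mul_ne_zero (mul_ne_zero h1 (pow_ne_zero 2 h0)) hC1) hC2)]
  refine mul_right_cancel₀ (mul_ne_zero (mul_ne_zero hf1 hf2) hf3) ?_
  linear_combination h

/-- By the product rule, the rational part of the logarithmic derivative of `F` and the derivative
of the certificate combine into the constant `-50`. -/
theorem deriv_wzG_eq_seriesTerm (n : ℕ) :
    32 * deriv (fun e : ℂ => wzG (1 / 2 + 7 * e) (1 / 2 + -5 * e) n 0) 0 =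
      (seriesTerm (n + 1) : ℂ) := by
  have h1 : (2 * n + 1 : ℂ) ≠ 0 := by exact_mod_cast Nat.succ_ne_zero (2 * n)
  have h5 : (6 * n + 5 : ℂ) ≠ 0 := by exact_mod_cast Nat.succ_ne_zero (6 * n + 4)
  have h := ((hasDerivAt_wzF_zero_right n).fun_mul (hasDerivAt_wzCert_zero_right n)).deriv
  simp only [mul_zero, add_zero] at h
  have hR : wzCert (1 / 2) (1 / 2) n 0 = (22 * n + 21) / (6 * (6 * n + 5)) := by
    have d0 : (1 / 2 + n + ((0 : ℕ) : ℂ) : ℂ) = (2 * n + 1) / 2 := by push_cast; ring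
    have d1 : (1 / 2 + 3 * n + ((0 : ℕ) : ℂ) + 1 : ℂ) = 3 * (2 * n + 1) / 2 := by push_cast; ring
    have d2 : (1 / 2 + 3 * n + ((0 : ℕ) : ℂ) + 2 : ℂ) = (6 * n + 5) / 2 := by push_cast; ring
    have d3 : (1 - 1 / 2 + n - ((0 : ℕ) : ℂ) : ℂ) = (2 * n + 1) / 2 := by push_cast; ring
    have e0 : (22 * n + 21 : ℂ) = 11 * (2 * n + 1) + 10 := by ring
    have e5 : (6 * n + 5 : ℂ) = 3 * (2 * n + 1) + 2 := by ring
    rw [wzCert, d0, d1, d2, d3, sub_self, zero_div, add_zero, add_comm 1 (2 * n : ℂ), e0]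
    clear h d0 d1 d2 d3
    generalize (2 * n + 1 : ℂ) = s at *
    generalize (6 * n + 5 : ℂ) = t at *
    field_simp
    rw [e5]
    ring
  rw [logDeriv_wzF_eq, hR] at h
  simp only [wzG]
  have e : (seriesTerm (n + 1) : ℂ) = 256 ^ (n + 1) /
      ((2 * n + 1) * (n + 1) ^ 2 * (Nat.choose (3 * (n + 1)) (n + 1) : ℂ) *
        (Nat.choose (6 * (n + 1)) (3 * (n + 1)) : ℂ)) *
      ((22 * n + 21) * (harmonicCombination (n + 1) : ℂ) - 50) := by
    rw [seriesTerm, div_mul_eq_mul_div]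
    push_cast
    congr 1 <;> ring
  have hw := wzF_half_eq n
  rw [h, e]
  generalize (256 : ℂ) ^ (n + 1) / _ = Q at *
  generalize (harmonicCombination (n + 1) : ℂ) = H at *
  have hQ : Q = wzF (1 / 2) (1 / 2) n 0 * 32 / (6 * (6 * n + 5)) := by
    rw [hw, mul_div_cancel_left₀ _ (mul_ne_zero (by norm_num) h5)]
  rw [hQ]
  generalize wzF (1 / 2) (1 / 2) n 0 = W at *
  have e2 : (22 * n + 21 : ℂ) = 11 * (2 * n + 1) + 10 := by ring
  have e5 : (6 * n + 5 : ℂ) = 3 * (2 * n + 1) + 2 := by ring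
  rw [e2]
  generalize (2 * n + 1 : ℂ) = s at *
  generalize (6 * n + 5 : ℂ) = t at *
  field_simp
  rw [e5]
  ring

theorem theorem1p9 :
    HasSum (fun n : ℕ => seriesTerm (n + 1)) (-16 * Real.pi ^ 3) := by
  rw [← Complex.hasSum_ofReal]
  have hF : HasSum (fun k => deriv (fun e : ℂ => wzF (1 / 2 + 7 * e) (1 / 2 + -5 * e) 0 k) 0)
      (-16 * ((Real.pi ^ 3 / 32 : ℝ) : ℂ)) := by
    simp only [deriv_wzF_zero_left]
    refine HasSum.mul_left _ ?_
    simpa using Complex.hasSum_ofReal.2 hasSum_neg_one_pow_div_odd_pow_three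
  have h := hasSum_deriv_wzG.mul_left 32
  simp only [deriv_wzG_eq_seriesTerm] at h
  rw [hF.tsum_eq] at h
  have e : ((-16 * Real.pi ^ 3 : ℝ) : ℂ) = 32 * (-16 * ((Real.pi ^ 3 / 32 : ℝ) : ℂ)) := by
    push_cast
    ring
  rwa [e]
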